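/- For $n\ge 1$ let $\mathrm{RankOne}_n$ be the communication problem in which Alice and Bob are given matrices $A,B\in\mathbb{F}_2^{n\times n}$ and have to decide whether $A+B$ has $\mathbb{F}_2$-rank at most $1$; we identify it with the $2^{n^2}\times 2^{n^2}$ real matrix, with rows and columns indexed by $\mathbb{F}_2^{n\times n}$, whose $(A,B)$ entry is $1$ if $\mathrm{rk}_{\mathbb{F}_2}(A+B)\le 1$ and $0$ otherwise. For a real matrix $M$ let $\gamma_2(M)=\min_{M=UV}\|U\|_{\mathrm{row}}\|V\|_{\mathrm{col}}$, where the minimum is over all factorizations of $M$ into real matrices $U,V$ of any inner dimension $d$, $\|U\|_{\mathrm{row}}$ is the maximum $\ell_2$-norm of a row of $U$, and $\|V\|_{\mathrm{col}}$ is the maximum $\ell_2$-norm of a column of $V$. Let $\mathsf{D}^{\mathrm{Eq}}(F)$ be the minimum cost (worst-case number of bits sent plus oracle queries) of a deterministic two-party protocol that computes $F$ with access to an Equality oracle, where a query consists of a string computed by Alice from her input and a string of the same length computed by Bob from his, and reveals to both whether the two strings are equal. Then \[ \gamma_2(\mathrm{RankOne}_n)=2^{\Theta(n)}\qquad\text{and}\qquad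 \mathsf{D}^{\mathrm{Eq}}(\mathrm{RankOne}_n)=\Omega(n), \] that is, there are constants $c,C,c'>0$ such that for all sufficiently large $n$, $2^{cn}\le\gamma_2(\mathrm{RankOne}_n)\le 2^{Cn}$ and $\mathsf{D}^{\mathrm{Eq}}(\mathrm{RankOne}_n)\ge c'n$. -/

import Mathlib

open Filter

/-- The largest Euclidean norm of a row of `U`. -/
noncomputable def rowNorm {ι κ : Type*} [Fintype κ] (U : Matrix ι κ ℝ) : ℝ :=
  ⨆ i, √(∑ k, U i k ^ 2)

/-- The largest Euclidean norm of a column of `V`. -/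
noncomputable def colNorm {κ ι : Type*} [Fintype κ] (V : Matrix κ ι ℝ) : ℝ :=
  ⨆ j, √(∑ k, V k j ^ 2)

/-- The `γ₂`-norm: the least value of `rowNorm U * colNorm V` over all factorizations `M = U * V`
through `ℝ ^ d`, for any dimension `d`. -/
noncomputable def gamma2 {ι ι' : Type*} [Fintype ι] [Fintype ι'] (M : Matrix ι ι' ℝ) : ℝ :=
  sInf {r : ℝ | ∃ (d : ℕ) (U : Matrix ι (Fin d) ℝ) (V : Matrix (Fin d) ι' ℝ),
    M = U * V ∧ r = rowNorm U * colNorm V}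

/-- The 0/1 matrix of a two-party communication problem. -/
def problemMatrix {X Y : Type*} (F : X → Y → Bool) : Matrix X Y ℝ :=
  Matrix.of fun x y => if F x y = true then 1 else 0

/-- The problem `RankOne_n`: decide whether `A + B` has rank at most one over `𝔽₂`. -/
noncomputable def RankOne (n : ℕ) (A B : Matrix (Fin n) (Fin n) (ZMod 2)) : Bool :=
  decide ((A + B).rank ≤ 1)

/-- Deterministic two-party protocols with access to an Equality oracle. In each step, either
Alice or Bob announces one bit, which may depend on their own input and on the position in the
tree, or they query the oracle on a pair of `k`-bit strings, one computed by each of them, and both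
learn whether the strings are equal. In each case the protocol continues in the first subtree on a
negative answer (`false`) and in the second one on a positive answer (`true`). -/
inductive EqProtocol (X Y : Type*) where
  | output (b : Bool) : EqProtocol X Y
  | alice (a : X → Bool) (P₀ P₁ : EqProtocol X Y) : EqProtocol X Y
  | bob (b : Y → Bool) (P₀ P₁ : EqProtocol X Y) : EqProtocol X Y
  | query (k : ℕ) (a : X → Fin k → Bool) (b : Y → Fin k → Bool) (P₀ P₁ : EqProtocol X Y) :
      EqProtocol X Y

namespace EqProtocol

/-- The output of a protocol on the inputs `x` (Alice) and `y` (Bob). -/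
def eval {X Y : Type*} : EqProtocol X Y → X → Y → Bool
  | output b, _, _ => b
  | alice a P₀ P₁, x, y => if a x = true then P₁.eval x y else P₀.eval x y
  | bob b P₀ P₁, x, y => if b y = true then P₁.eval x y else P₀.eval x y
  | query _ a b P₀ P₁, x, y => if a x = b y then P₁.eval x y else P₀.eval x y

/-- The cost of a protocol: the depth of its tree, that is, the number of bits announced and oracle
queries made in the worst case. -/
def cost {X Y : Type*} : EqProtocol X Y → ℕ
  | output _ => 0
  | alice _ P₀ P₁ => max P₀.cost P₁.cost + 1
  | bob _ P₀ P₁ => max P₀.cost P₁.cost + 1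
  | query _ _ _ P₀ P₁ => max P₀.cost P₁.cost + 1

/-- On finite inputs every problem is computed by some protocol, so that the minimum in `DEq` is
over a nonempty set. -/
theorem exists_computes {X Y : Type*} [Finite X] (F : X → Y → Bool) :
    ∃ P : EqProtocol X Y, ∀ x y, P.eval x y = F x y := by
  classical
  cases nonempty_fintype X
  suffices h : ∀ s : Finset X, ∃ P : EqProtocol X Y, ∀ x ∈ s, ∀ y, P.eval x y = F x y by
    obtain ⟨P, hP⟩ := h Finset.univ
    exact ⟨P, fun x y => hP x (Finset.mem_univ x) y⟩
  intro s
  induction s using Finset.induction_on with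
  | empty => exact ⟨output true, by simp⟩
  | insert c s _ ih =>
    obtain ⟨P, hP⟩ := ih
    refine ⟨alice (fun x => decide (x = c)) P (bob (F c) (output false) (output true)), ?_⟩
    intro x hx y
    by_cases hxc : x = c
    · subst hxc
      simp [eval]
    · simpa [eval, hxc] using hP x ((Finset.mem_insert.1 hx).resolve_left hxc) y

end EqProtocol

/-- `D^Eq(F)`: the minimum cost of a deterministic protocol with access to an Equality oracle that
computes `F` on all inputs. -/
noncomputable def DEq {X Y : Type*} [Finite X] [Finite Y] (F : X → Y → Bool) : ℕ :=
  sInf {c : ℕ | ∃ P : EqProtocol X Y, (∀ x y, P.eval x y = F x y) ∧ P.cost = c}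

/-! The entry at `(A, B)` depends only on `A + B`, so the characters of the group of matrices
diagonalize `problemMatrix (RankOne n)`, with the Fourier coefficients of the rank-at-most-one
indicator as eigenvalues. By Parseval and Cauchy–Schwarz, the mean absolute eigenvalue is at most
the product of the row and column norms of any factorization (`sum_abs_le_of_factorization`). At an
invertible `S` the coefficient is `2 - 2 ^ n` (`sum_matrixChar_rank_le_one`), and at least a quarter
of all matrices are invertible (`card_le_four_mul_card_isUnit`), so `γ₂` is at least `(2 ^ n - 2) /
4`. The upper bound uses the factorization `1 * M`, since each column of `M` has at most `4 ^ n`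
ones.

An Equality matrix has `γ₂` at most 1, and `γ₂` is subadditive and submultiplicative under entrywise
products. Each protocol step thus costs at most a factor 3 (`EqProtocol.hasGram_eval`), and the
lower bound on `γ₂` forces linear depth. -/

/-! ### Factorizations and orthogonal bases -/

open Finset in
theorem sum_sq_orthogonal {X : Type*} [Fintype X] [DecidableEq X] {H : Matrix X X ℝ} {N : ℝ}
    (hH : ∀ A B, ∑ S, H S A * H S B = if A = B then N else 0) (f : X → ℝ) :
    ∑ S, (∑ A, H S A * f A) ^ 2 = N * ∑ A, f A ^ 2 := by
  have h1 : ∀ S, (∑ A, H S A * f A) ^ 2 = ∑ A, ∑ B, (f A * f B) * (H S A * H S B) := by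
    intro S
    rw [sq, sum_mul_sum]
    exact sum_congr rfl fun A _ => sum_congr rfl fun B _ => by ring
  simp_rw [h1]
  rw [sum_comm, mul_sum]
  refine sum_congr rfl fun A _ => ?_
  rw [sum_comm]
  simp_rw [← mul_sum, hH]
  simp
  ring

open Finset in
/-- A factorization of `M` bounds the diagonal of `M` in every orthogonal basis. -/
theorem sum_abs_le_of_factorization {X κ : Type*} [Fintype X] [DecidableEq X] [Fintype κ]
    {H : Matrix X X ℝ} {N : ℝ} (hN : 0 ≤ N)
    (hH : ∀ A B, ∑ S, H S A * H S B = if A = B then N else 0)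
    (U : Matrix X κ ℝ) (V : Matrix κ X ℝ) {a b : ℝ} (ha : 0 ≤ a) (hb : 0 ≤ b)
    (hU : ∀ A, ∑ k, U A k ^ 2 ≤ a ^ 2) (hV : ∀ B, ∑ k, V k B ^ 2 ≤ b ^ 2) :
    ∑ S, |∑ A, ∑ B, H S A * H S B * (U * V) A B| ≤ N * (Fintype.card X * (a * b)) := by
  set p : X → κ → ℝ := fun S k => ∑ A, H S A * U A k
  set q : X → κ → ℝ := fun S k => ∑ B, H S B * V k B
  have key : ∀ S, ∑ A, ∑ B, H S A * H S B * (U * V) A B = ∑ k, p S k * q S k := by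
    intro S
    simp only [p, q, sum_mul_sum]
    simp only [Matrix.mul_apply, mul_sum]
    symm
    rw [sum_comm]
    refine sum_congr rfl fun A _ => ?_
    rw [sum_comm]
    exact sum_congr rfl fun B _ => sum_congr rfl fun k _ => by ring
  have hp : ∑ S, ∑ k, p S k ^ 2 ≤ N * (Fintype.card X * a ^ 2) := by
    rw [sum_comm]
    simp only [p, sum_sq_orthogonal hH]
    rw [← mul_sum, sum_comm]
    refine mul_le_mul_of_nonneg_left ?_ hN
    calc _ ≤ ∑ _A : X, a ^ 2 := sum_le_sum fun A _ => hU A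
      _ = _ := by simp
  have hq : ∑ S, ∑ k, q S k ^ 2 ≤ N * (Fintype.card X * b ^ 2) := by
    rw [sum_comm]
    simp only [q, sum_sq_orthogonal hH]
    rw [← mul_sum, sum_comm]
    refine mul_le_mul_of_nonneg_left ?_ hN
    calc _ ≤ ∑ _A : X, b ^ 2 := sum_le_sum fun A _ => hV A
      _ = _ := by simp
  have hc : (0 : ℝ) ≤ N * Fintype.card X := by positivity
  calc ∑ S, |∑ A, ∑ B, H S A * H S B * (U * V) A B|
      ≤ ∑ S, ∑ k, |p S k| * |q S k| := by
        refine sum_le_sum fun S _ => ?_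
        rw [key]
        simpa only [abs_mul] using abs_sum_le_sum_abs (fun k => p S k * q S k) univ
    _ = ∑ z : X × κ, |p z.1 z.2| * |q z.1 z.2| :=
        (Fintype.sum_prod_type' fun S k => |p S k| * |q S k|).symm
    _ ≤ N * (Fintype.card X * (a * b)) := by
        -- Cauchy–Schwarz over all pairs `(S, k)` at once; Parseval, in `hp` and `hq`, bounds the
        -- two factors.
        refine abs_le_of_sq_le_sq' ?_ (by positivity) |>.2
        refine (sum_mul_sq_le_sq_mul_sq _ _ _).trans ?_
        simp only [sq_abs]
        rw [Fintype.sum_prod_type, Fintype.sum_prod_type]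
        calc _ ≤ (N * (Fintype.card X * a ^ 2)) * (N * (Fintype.card X * b ^ 2)) :=
              mul_le_mul hp hq (by positivity) (by positivity)
          _ = _ := by ring

/-! ### Characters and the Fourier transform of the rank-one indicator -/

/-- The nontrivial character of `𝔽₂`. -/
def signChar (z : ZMod 2) : ℝ := if z = 0 then 1 else -1

theorem signChar_zero : signChar 0 = 1 := by simp [signChar]

theorem signChar_one : signChar 1 = -1 := by simp [signChar]

theorem signChar_add (y z : ZMod 2) : signChar (y + z) = signChar y * signChar z := by
  have h : y + z = 0 ↔ (y = 0 ↔ z = 0) := by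
    revert y z
    decide
  by_cases hy : y = 0 <;> by_cases hz : z = 0 <;> simp [signChar, h, hy, hz]

/-- Translation by some `w` with `φ w = 1` permutes the summands and flips every sign. -/
theorem sum_signChar_eq_zero {G : Type*} [AddCommGroup G] [Fintype G] (φ : G →+ ZMod 2)
    (hφ : φ ≠ 0) : ∑ x, signChar (φ x) = 0 := by
  obtain ⟨w, hw⟩ := DFunLike.ne_iff.1 hφ
  have hw1 : φ w = 1 := by
    have h : ∀ z : ZMod 2, z ≠ 0 → z = 1 := by decide
    exact h _ hw
  have h : ∑ x, signChar (φ x) = ∑ x, signChar (φ (x + w)) :=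
    (Equiv.sum_comp (Equiv.addRight w) fun x => signChar (φ x)).symm
  simp only [map_add, signChar_add, hw1, signChar_one, mul_neg, mul_one,
    Finset.sum_neg_distrib] at h
  linarith

section MatrixCharacters

variable {n : ℕ}

/-- The entrywise pairing of matrices, as an additive map in the first argument. -/
def entryPairing (A : Matrix (Fin n) (Fin n) (ZMod 2)) :
    Matrix (Fin n) (Fin n) (ZMod 2) →+ ZMod 2 where
  toFun S := ∑ i, ∑ j, S i j * A i j
  map_zero' := by simp
  map_add' S T := by simp [add_mul, Finset.sum_add_distrib]

theorem entryPairing_comm (A S : Matrix (Fin n) (Fin n) (ZMod 2)) :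
    entryPairing A S = entryPairing S A := by
  simp [entryPairing, mul_comm]

theorem entryPairing_ne_zero {A : Matrix (Fin n) (Fin n) (ZMod 2)} (hA : A ≠ 0) :
    entryPairing A ≠ 0 := by
  contrapose! hA
  ext i j
  have := DFunLike.congr_fun hA (Matrix.single i j 1)
  simpa [entryPairing, Matrix.single_apply, ite_and] using this

theorem entryPairing_vecMulVec (S : Matrix (Fin n) (Fin n) (ZMod 2)) (u v : Fin n → ZMod 2) :
    entryPairing S (Matrix.vecMulVec u v) = u ⬝ᵥ S.mulVec v := by
  simp only [entryPairing, AddMonoidHom.coe_mk, ZeroHom.coe_mk, Matrix.vecMulVec_apply,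
    dotProduct, Matrix.mulVec, Finset.mul_sum]
  exact Finset.sum_congr rfl fun i _ => Finset.sum_congr rfl fun j _ => by ring

theorem matrix_zmod_two_add_self (A : Matrix (Fin n) (Fin n) (ZMod 2)) : A + A = 0 := by
  ext i j
  exact CharTwo.add_self_eq_zero _

/-- The character table of the group of `n × n` matrices over `𝔽₂`. -/
def matrixChar (n : ℕ) :
    Matrix (Matrix (Fin n) (Fin n) (ZMod 2)) (Matrix (Fin n) (Fin n) (ZMod 2)) ℝ :=
  Matrix.of fun S A => signChar (entryPairing S A)

theorem matrixChar_add (S A B : Matrix (Fin n) (Fin n) (ZMod 2)) :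
    matrixChar n S (A + B) = matrixChar n S A * matrixChar n S B := by
  simp [matrixChar, signChar_add]

theorem matrixChar_orthogonal (A B : Matrix (Fin n) (Fin n) (ZMod 2)) :
    ∑ S, matrixChar n S A * matrixChar n S B =
      if A = B then (Fintype.card (Matrix (Fin n) (Fin n) (ZMod 2)) : ℝ) else 0 := by
  simp_rw [← matrixChar_add]
  simp only [matrixChar, Matrix.of_apply]
  simp_rw [fun S => entryPairing_comm S (A + B)]
  split_ifs with h
  · subst h
    have h1 : entryPairing (0 : Matrix (Fin n) (Fin n) (ZMod 2)) = 0 := by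
      ext S
      simp [entryPairing]
    simp [matrix_zmod_two_add_self, h1, signChar_zero]
  · refine sum_signChar_eq_zero _ (entryPairing_ne_zero fun h0 => h ?_)
    ext i j
    have := congrFun (congrFun h0 i) j
    exact CharTwo.add_eq_zero.1 this

/-- A single `u` spans the column space; `v` lists the scalars that express the columns through it.
-/
theorem exists_vecMulVec_of_rank_le_one {K : Type*} [Field K] {X : Matrix (Fin n) (Fin n) K}
    (h : X.rank ≤ 1) : ∃ u v, X = Matrix.vecMulVec u v := by
  rw [Matrix.rank, finrank_le_one_iff] at h
  obtain ⟨u, hu⟩ := h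
  choose c hc using hu
  refine ⟨u, fun j => c ⟨X.mulVecLin (Pi.single j 1), LinearMap.mem_range_self _ _⟩, ?_⟩
  ext i j
  have := congrArg (fun w : LinearMap.range X.mulVecLin => (w : Fin n → K) i)
    (hc ⟨X.mulVecLin (Pi.single j 1), LinearMap.mem_range_self _ _⟩)
  simp only [Submodule.coe_smul, Pi.smul_apply, smul_eq_mul, Matrix.mulVecLin_apply,
    Matrix.mulVec_single_one, Matrix.col_apply] at this
  rw [Matrix.vecMulVec_apply, mul_comm, ← this]
  simp only [Matrix.mulVecLin_apply, Matrix.mulVec_single_one]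

theorem zmod_two_mul_eq_one {a b : ZMod 2} : a * b = 1 ↔ a = 1 ∧ b = 1 := by
  revert a b
  decide

theorem zmod_two_ne_zero {a : ZMod 2} : a ≠ 0 ↔ a = 1 := by
  revert a
  decide

/-- The usual scalar ambiguity disappears because 1 is the only nonzero scalar in `𝔽₂`. -/
theorem vecMulVec_eq_vecMulVec_iff {u v u' v' : Fin n → ZMod 2} (hu : u ≠ 0) (hv : v ≠ 0)
    (h : Matrix.vecMulVec u v = Matrix.vecMulVec u' v') : u = u' ∧ v = v' := by
  obtain ⟨i, hi⟩ := Function.ne_iff.1 hu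
  obtain ⟨j, hj⟩ := Function.ne_iff.1 hv
  have hi1 : u i = 1 := zmod_two_ne_zero.1 hi
  have hj1 : v j = 1 := zmod_two_ne_zero.1 hj
  have e : ∀ k l, u k * v l = u' k * v' l := fun k l => congrFun (congrFun h k) l
  have h1 := e i j
  rw [hi1, hj1, one_mul, eq_comm, zmod_two_mul_eq_one] at h1
  refine ⟨funext fun k => ?_, funext fun l => ?_⟩
  · simpa [hj1, h1.2] using e k j
  · simpa [hi1, h1.1] using e i l

open Finset in
theorem filter_rank_le_one_eq [DecidablePred fun X : Matrix (Fin n) (Fin n) (ZMod 2) => X.rank ≤ 1] :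
    (univ.filter fun X : Matrix (Fin n) (Fin n) (ZMod 2) => X.rank ≤ 1) =
      insert 0 (((univ.erase 0) ×ˢ (univ.erase 0)).image
        fun p : (Fin n → ZMod 2) × (Fin n → ZMod 2) => Matrix.vecMulVec p.1 p.2) := by
  ext X
  simp only [mem_filter, mem_univ, true_and, mem_insert, mem_image, mem_product, mem_erase,
    and_true, Prod.exists]
  constructor
  · intro h
    obtain ⟨u, v, rfl⟩ := exists_vecMulVec_of_rank_le_one h
    by_cases hu : u = 0
    · left
      simp [hu]
    by_cases hv : v = 0
    · left
      simp [hv]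
    exact Or.inr ⟨u, v, ⟨hu, hv⟩, rfl⟩
  · rintro (rfl | ⟨u, v, -, rfl⟩)
    · simp
    · exact Matrix.rank_vecMulVec_le u v

theorem sum_signChar_dotProduct (w : Fin n → ZMod 2) :
    ∑ u, signChar (u ⬝ᵥ w) = if w = 0 then (2 : ℝ) ^ n else 0 := by
  split_ifs with h
  · simp [h, signChar_zero]
  · let φ : (Fin n → ZMod 2) →+ ZMod 2 :=
      { toFun := fun u => u ⬝ᵥ w
        map_zero' := zero_dotProduct w
        map_add' := fun u v => add_dotProduct u v w }
    refine sum_signChar_eq_zero φ fun h0 => h ?_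
    ext i
    simpa [φ] using DFunLike.congr_fun h0 (Pi.single i 1)

open Finset in
/-- The Fourier coefficients of the rank-one indicator at invertible matrices. -/
theorem sum_matrixChar_rank_le_one {S : Matrix (Fin n) (Fin n) (ZMod 2)} (hS : IsUnit S)
    [DecidablePred fun X : Matrix (Fin n) (Fin n) (ZMod 2) => X.rank ≤ 1] :
    ∑ X with X.rank ≤ 1, matrixChar n S X = 2 - (2 : ℝ) ^ n := by
  rw [filter_rank_le_one_eq, sum_insert, sum_image, sum_product_right]
  · have hv : ∀ v : Fin n → ZMod 2, S.mulVec v = 0 ↔ v = 0 := fun v =>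
      ⟨fun h => Matrix.mulVec_injective_of_isUnit hS (by simpa using h), fun h => by simp [h]⟩
    simp only [matrixChar, Matrix.of_apply, entryPairing_vecMulVec, map_zero, signChar_zero]
    -- For `v ≠ 0` also `S v ≠ 0`, so the sum over `u ≠ 0` is `0 - 1`. The `2 ^ n - 1` such `v` give
    -- `1 - 2 ^ n`, and the zero matrix adds 1.
    simp only [sum_erase_eq_sub (mem_univ _), sum_sub_distrib, sum_signChar_dotProduct, hv,
      zero_dotProduct, signChar_zero]
    simp
    ring
  · rintro ⟨u, v⟩ h ⟨u', v'⟩ - he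
    simp only [coe_product, Set.mem_prod, mem_coe, mem_erase, mem_univ, and_true] at h
    obtain ⟨rfl, rfl⟩ := vecMulVec_eq_vecMulVec_iff h.1 h.2 he
    rfl
  · simp only [mem_image, mem_product, mem_erase, mem_univ, and_true, Prod.exists, not_exists,
      not_and]
    rintro u v ⟨hu, hv⟩ h
    rw [← Matrix.vecMulVec_zero (0 : Fin n → ZMod 2)] at h
    exact hu (vecMulVec_eq_vecMulVec_iff hu hv h).1

open Finset in
theorem card_rank_le_one_le
    [DecidablePred fun X : Matrix (Fin n) (Fin n) (ZMod 2) => X.rank ≤ 1] :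
    #{X : Matrix (Fin n) (Fin n) (ZMod 2) | X.rank ≤ 1} ≤ (2 ^ n) ^ 2 := by
  have h : (univ.filter fun X : Matrix (Fin n) (Fin n) (ZMod 2) => X.rank ≤ 1) ⊆
      univ.image fun p : (Fin n → ZMod 2) × (Fin n → ZMod 2) => Matrix.vecMulVec p.1 p.2 := by
    intro X hX
    obtain ⟨u, v, rfl⟩ := exists_vecMulVec_of_rank_le_one (mem_filter.1 hX).2
    exact mem_image.2 ⟨(u, v), mem_univ _, rfl⟩
  refine (card_le_card h).trans (card_image_le.trans ?_)
  simp [sq]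

end MatrixCharacters

/-! ### Density of the invertible matrices -/

/-- The term `(1 / 2) ^ (n + 2)` strengthens the bound `1 / 4` so that induction closes. -/
theorem quarter_le_prod_one_sub (n : ℕ) :
    (1 / 4 + (1 / 2) ^ (n + 2) : ℝ) ≤ ∏ i ∈ Finset.range (n + 1), (1 - (1 / 2 : ℝ) ^ (i + 1)) := by
  induction n with
  | zero => norm_num
  | succ n ih =>
    rw [Finset.prod_range_succ]
    have h0 : (0 : ℝ) < (1 / 2) ^ n := by positivity
    have h1 : ((1 : ℝ) / 2) ^ n ≤ 1 := pow_le_one₀ (by norm_num) (by norm_num)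
    refine le_trans ?_ (mul_le_mul_of_nonneg_right ih ?_)
    · simp only [pow_succ]
      nlinarith
    · simp only [pow_succ]
      linarith

open Finset in
theorem card_le_four_mul_card_isUnit {n : ℕ} (hn : 1 ≤ n)
    [DecidablePred fun S : Matrix (Fin n) (Fin n) (ZMod 2) => IsUnit S] :
    (Fintype.card (Matrix (Fin n) (Fin n) (ZMod 2)) : ℝ) ≤
      4 * #{S : Matrix (Fin n) (Fin n) (ZMod 2) | IsUnit S} := by
  have hcard : Nat.card (GL (Fin n) (ZMod 2)) =
      #{S : Matrix (Fin n) (Fin n) (ZMod 2) | IsUnit S} := by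
    rw [← Fintype.card_subtype, Nat.card_eq_fintype_card]
    refine Fintype.card_congr (Equiv.ofBijective (fun g => ⟨g.1, g.isUnit⟩) ⟨?_, ?_⟩)
    · intro g h hgh
      exact Units.ext (congrArg Subtype.val hgh)
    · rintro ⟨_, g, rfl⟩
      exact ⟨g, rfl⟩
  have hN : (Fintype.card (Matrix (Fin n) (Fin n) (ZMod 2)) : ℝ) = ∏ _i ∈ range n, (2 : ℝ) ^ n := by
    rw [Fintype.card_congr (Matrix.of (m := Fin n) (n := Fin n) (α := ZMod 2)).symm]
    simp
  rw [← hcard, Matrix.card_GL_field, ZMod.card, Fin.prod_univ_eq_prod_range fun i => 2 ^ n - 2 ^ i,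
    hN,
    Nat.cast_prod, ← prod_range_reflect (fun i => ((2 ^ n - 2 ^ i : ℕ) : ℝ))]
  obtain ⟨m, rfl⟩ := Nat.exists_eq_add_of_le' hn
  have h : ∀ i ∈ range (m + 1), ((2 ^ (m + 1) - 2 ^ (m + 1 - 1 - i) : ℕ) : ℝ) =
      2 ^ (m + 1) * (1 - (1 / 2 : ℝ) ^ (i + 1)) := by
    intro i hi
    have hi' : i ≤ m := Nat.lt_succ_iff.1 (mem_range.1 hi)
    obtain ⟨k, rfl⟩ := Nat.exists_eq_add_of_le' hi'
    rw [Nat.cast_sub (Nat.pow_le_pow_right (by norm_num) (by omega))]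
    have : k + i + 1 - 1 - i = k := by omega
    rw [this]
    push_cast
    rw [mul_sub, mul_one, add_assoc, pow_add, mul_assoc, ← mul_pow]
    norm_num
  rw [prod_congr rfl h, prod_mul_distrib]
  have h2 := quarter_le_prod_one_sub m
  have h3 : (0 : ℝ) ≤ (1 / 2) ^ (m + 2) := by positivity
  have h4 : (0 : ℝ) ≤ ∏ _i ∈ range (m + 1), (2 : ℝ) ^ (m + 1) := prod_nonneg fun _ _ => by positivity
  nlinarith

/-! ### Bounds on `γ₂` -/

open Finset in
/-- Every factorization of the matrix of `RankOne n` has large row and column norms. -/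
theorem two_pow_sub_two_le_of_factorization {n : ℕ} (hn : 1 ≤ n) {κ : Type*} [Fintype κ]
    {U : Matrix (Matrix (Fin n) (Fin n) (ZMod 2)) κ ℝ}
    {V : Matrix κ (Matrix (Fin n) (Fin n) (ZMod 2)) ℝ}
    (hM : problemMatrix (RankOne n) = U * V) {a b : ℝ} (ha : 0 ≤ a) (hb : 0 ≤ b)
    (hU : ∀ A, ∑ k, U A k ^ 2 ≤ a ^ 2) (hV : ∀ B, ∑ k, V k B ^ 2 ≤ b ^ 2) :
    (2 : ℝ) ^ n - 2 ≤ 4 * (a * b) := by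
  classical
  set N : ℝ := (Fintype.card (Matrix (Fin n) (Fin n) (ZMod 2)) : ℝ)
  have hN : 0 < N := by simp only [N]; exact_mod_cast Fintype.card_pos
  have key := sum_abs_le_of_factorization hN.le matrixChar_orthogonal U V ha hb hU hV
  rw [← hM] at key
  -- Characters multiply to the character at `A + B`; substituting `X = A + B` makes every row
  -- contribute the same Fourier coefficient.
  have hdiag : ∀ S, ∑ A, ∑ B, matrixChar n S A * matrixChar n S B * problemMatrix (RankOne n) A B
      = N * ∑ X with X.rank ≤ 1, matrixChar n S X := by
    intro S
    have h : ∀ A, ∑ B, matrixChar n S A * matrixChar n S B * problemMatrix (RankOne n) A B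
        = ∑ X with X.rank ≤ 1, matrixChar n S X := by
      intro A
      rw [sum_filter, ← Equiv.sum_comp (Equiv.addLeft A)]
      refine sum_congr rfl fun B _ => ?_
      have hA : A + (A + B) = B := by
        rw [← add_assoc, matrix_zmod_two_add_self, zero_add]
      simp [← matrixChar_add, problemMatrix, RankOne, hA]
    simp [h, N]
  simp_rw [hdiag] at key
  -- Only the invertible `S` are kept.
  have h1 : ∑ S : Matrix (Fin n) (Fin n) (ZMod 2) with IsUnit S, N * ((2 : ℝ) ^ n - 2) ≤
      ∑ S, |N * ∑ X with X.rank ≤ 1, matrixChar n S X| := by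
    refine le_trans (sum_le_sum fun S hS => ?_)
      (sum_le_sum_of_subset_of_nonneg (filter_subset _ univ) fun _ _ _ => abs_nonneg _)
    rw [sum_matrixChar_rank_le_one (mem_filter.1 hS).2, abs_mul, abs_of_pos hN]
    refine mul_le_mul_of_nonneg_left ?_ hN.le
    rw [abs_sub_comm]
    exact le_abs_self _
  have h2 := h1.trans key
  rw [sum_const, nsmul_eq_mul] at h2
  have h3 := card_le_four_mul_card_isUnit hn
  have h4 : (0 : ℝ) ≤ (2 : ℝ) ^ n - 2 := by
    have : (2 : ℝ) ^ 1 ≤ 2 ^ n := pow_le_pow_right₀ (by norm_num) hn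
    linarith
  have h5 : N * (N * ((2 : ℝ) ^ n - 2)) ≤ N * (N * (4 * (a * b))) := by
    calc _ ≤ 4 * #{S : Matrix (Fin n) (Fin n) (ZMod 2) | IsUnit S} * (N * ((2 : ℝ) ^ n - 2)) :=
          mul_le_mul_of_nonneg_right h3 (by positivity)
      _ ≤ N * (N * (4 * (a * b))) := by linarith
  exact le_of_mul_le_mul_left (le_of_mul_le_mul_left h5 hN) hN

theorem sum_sq_le_rowNorm_sq {ι κ : Type*} [Finite ι] [Fintype κ] (U : Matrix ι κ ℝ) (i : ι) :
    ∑ k, U i k ^ 2 ≤ rowNorm U ^ 2 := by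
  have h : √(∑ k, U i k ^ 2) ≤ rowNorm U :=
    le_ciSup (f := fun i => √(∑ k, U i k ^ 2)) (Set.finite_range _).bddAbove i
  exact (Real.sqrt_le_iff.1 h).2

theorem sum_sq_le_colNorm_sq {ι κ : Type*} [Finite ι] [Fintype κ] (V : Matrix κ ι ℝ) (j : ι) :
    ∑ k, V k j ^ 2 ≤ colNorm V ^ 2 :=
  sum_sq_le_rowNorm_sq V.transpose j

theorem rowNorm_nonneg {ι κ : Type*} [Fintype κ] (U : Matrix ι κ ℝ) : 0 ≤ rowNorm U :=
  Real.iSup_nonneg fun _ => Real.sqrt_nonneg _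

theorem colNorm_nonneg {ι κ : Type*} [Fintype κ] (V : Matrix κ ι ℝ) : 0 ≤ colNorm V :=
  Real.iSup_nonneg fun _ => Real.sqrt_nonneg _

theorem gamma2_le_of_factorization {ι ι' κ : Type*} [Fintype ι] [Fintype ι'] [Fintype κ]
    {M : Matrix ι ι' ℝ} {U : Matrix ι κ ℝ} {V : Matrix κ ι' ℝ} (hM : M = U * V) {a b : ℝ}
    (ha : 0 ≤ a) (hb : 0 ≤ b) (hU : ∀ i, ∑ k, U i k ^ 2 ≤ a ^ 2)
    (hV : ∀ j, ∑ k, V k j ^ 2 ≤ b ^ 2) : gamma2 M ≤ a * b := by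
  let e := (Fintype.equivFin κ).symm
  have hle : gamma2 M ≤ rowNorm (U.submatrix id e) * colNorm (V.submatrix e id) := by
    refine csInf_le ⟨0, ?_⟩ ⟨_, U.submatrix id e, V.submatrix e id, ?_, rfl⟩
    · rintro _ ⟨d, U', V', -, rfl⟩
      exact mul_nonneg (rowNorm_nonneg _) (colNorm_nonneg _)
    · rw [Matrix.submatrix_mul_equiv, hM, Matrix.submatrix_id_id]
  refine hle.trans (mul_le_mul ?_ ?_ (colNorm_nonneg _) ha)
  · refine Real.iSup_le (fun i => Real.sqrt_le_iff.2 ⟨ha, ?_⟩) ha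
    exact (Equiv.sum_comp e fun k => U i k ^ 2).trans_le (hU i)
  · refine Real.iSup_le (fun j => Real.sqrt_le_iff.2 ⟨hb, ?_⟩) hb
    exact (Equiv.sum_comp e fun k => V k j ^ 2).trans_le (hV j)

theorem le_gamma2 {ι ι' : Type*} [Fintype ι] [Fintype ι'] {M : Matrix ι ι' ℝ} {r : ℝ}
    (h : ∀ (d : ℕ) (U : Matrix ι (Fin d) ℝ) (V : Matrix (Fin d) ι' ℝ), M = U * V →
      r ≤ rowNorm U * colNorm V) : r ≤ gamma2 M := by
  classical
  refine le_csInf ?_ ?_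
  -- The factorization `1 * M` shows that the infimum is not the default value 0 of an empty set.
  · let e := (Fintype.equivFin ι).symm
    refine ⟨_, Fintype.card ι, (1 : Matrix ι ι ℝ).submatrix id e, M.submatrix e id, ?_, rfl⟩
    rw [Matrix.submatrix_mul_equiv, Matrix.one_mul, Matrix.submatrix_id_id]
  · rintro _ ⟨d, U, V, hM, rfl⟩
    exact h d U V hM

open Finset in
theorem gamma2_rankOne_le (n : ℕ) : gamma2 (problemMatrix (RankOne n)) ≤ 2 ^ n := by
  classical
  rw [← one_mul ((2 : ℝ) ^ n)]
  refine gamma2_le_of_factorization (one_mul _).symm zero_le_one (by positivity) ?_ ?_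
  · intro i
    simp [Matrix.one_apply]
  · intro B
    have h : ∑ A, problemMatrix (RankOne n) A B ^ 2 =
        #{X : Matrix (Fin n) (Fin n) (ZMod 2) | X.rank ≤ 1} := by
      rw [card_filter, Nat.cast_sum, ← Equiv.sum_comp (Equiv.addRight B)]
      refine sum_congr rfl fun A _ => ?_
      have hB : A + B + B = A := by
        rw [add_assoc, matrix_zmod_two_add_self, add_zero]
      simp [problemMatrix, RankOne, hB]
    rw [h]
    exact_mod_cast card_rank_le_one_le

theorem two_pow_sub_two_le_gamma2_rankOne {n : ℕ} (hn : 1 ≤ n) :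
    ((2 : ℝ) ^ n - 2) / 4 ≤ gamma2 (problemMatrix (RankOne n)) := by
  refine le_gamma2 fun d U V hM => ?_
  have := two_pow_sub_two_le_of_factorization hn hM (rowNorm_nonneg U) (colNorm_nonneg V)
    (sum_sq_le_rowNorm_sq U) (sum_sq_le_colNorm_sq V)
  linarith

/-! ### From Equality protocols to factorizations -/

/-- `M` is the matrix of inner products of vectors of squared length at most `r`. -/
def HasGram {X Y : Type*} (M : X → Y → ℝ) (r : ℝ) : Prop :=
  ∃ (κ : Type) (_ : Fintype κ) (u : X → κ → ℝ) (v : Y → κ → ℝ),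
    (∀ x y, M x y = ∑ k, u x k * v y k) ∧ (∀ x, ∑ k, u x k ^ 2 ≤ r) ∧ ∀ y, ∑ k, v y k ^ 2 ≤ r

namespace HasGram

variable {X Y : Type*} {M M' : X → Y → ℝ} {r s : ℝ}

theorem mono (h : HasGram M r) (hrs : r ≤ s) : HasGram M s := by
  obtain ⟨κ, _, u, v, hM, hu, hv⟩ := h
  exact ⟨κ, _, u, v, hM, fun x => (hu x).trans hrs, fun y => (hv y).trans hrs⟩

theorem add (h : HasGram M r) (h' : HasGram M' s) : HasGram (fun x y => M x y + M' x y) (r + s) := by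
  obtain ⟨κ, _, u, v, hM, hu, hv⟩ := h
  obtain ⟨κ', _, u', v', hM', hu', hv'⟩ := h'
  refine ⟨κ ⊕ κ', inferInstance, fun x => Sum.elim (u x) (u' x), fun y => Sum.elim (v y) (v' y),
    ?_, ?_, ?_⟩
  · intro x y
    simp [hM, hM']
  · intro x
    simpa using add_le_add (hu x) (hu' x)
  · intro y
    simpa using add_le_add (hv y) (hv' y)

theorem neg (h : HasGram M r) : HasGram (fun x y => -M x y) r := by
  obtain ⟨κ, _, u, v, hM, hu, hv⟩ := h
  exact ⟨κ, _, fun x k => -u x k, v, by simp [hM], by simpa using hu, hv⟩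

/-- Tensor products of vectors multiply both inner products and squared lengths. -/
theorem mul (hr : 0 ≤ r) (h : HasGram M r) (h' : HasGram M' s) :
    HasGram (fun x y => M x y * M' x y) (r * s) := by
  obtain ⟨κ, _, u, v, hM, hu, hv⟩ := h
  obtain ⟨κ', _, u', v', hM', hu', hv'⟩ := h'
  refine ⟨κ × κ', inferInstance, fun x k => u x k.1 * u' x k.2, fun y k => v y k.1 * v' y k.2,
    ?_, ?_, ?_⟩
  · intro x y
    simp only [hM, hM', Finset.sum_mul_sum]
    rw [Fintype.sum_prod_type]
    exact Finset.sum_congr rfl fun _ _ => Finset.sum_congr rfl fun _ _ => by ring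
  · intro x
    simp only [mul_pow, Fintype.sum_prod_type, ← Finset.sum_mul_sum]
    exact mul_le_mul (hu x) (hu' x) (Finset.sum_nonneg fun _ _ => sq_nonneg _) hr
  · intro y
    simp only [mul_pow, Fintype.sum_prod_type, ← Finset.sum_mul_sum]
    exact mul_le_mul (hv y) (hv' y) (Finset.sum_nonneg fun _ _ => sq_nonneg _) hr

/-- The vectors are the standard basis vectors at `f x` and `g y`. -/
theorem ite_eq {α : Type} [Fintype α] [DecidableEq α] (f : X → α) (g : Y → α) :
    HasGram (fun x y => if f x = g y then 1 else 0) 1 :=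
  ⟨α, inferInstance, fun x k => if f x = k then 1 else 0, fun y k => if g y = k then 1 else 0,
    by simp [eq_comm], by simp, by simp⟩

theorem const {c : ℝ} (hc : c ^ 2 ≤ 1) : HasGram (fun (_ : X) (_ : Y) => c) 1 :=
  ⟨Unit, inferInstance, fun _ _ => c, fun _ _ => 1, by simp, fun _ => by simpa using hc, by simp⟩

/-- Writing `E` for its indicator, the matrix is `E * M - E * M' + M'` entrywise: three terms, each
of bound `r`. -/
theorem ite {E : X → Y → Prop} [∀ x y, Decidable (E x y)]
    (hE : HasGram (fun x y => if E x y then (1 : ℝ) else 0) 1)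
    (h : HasGram M r) (h' : HasGram M' r) :
    HasGram (fun x y => if E x y then M x y else M' x y) (3 * r) := by
  have key := ((mul zero_le_one hE h).add (mul zero_le_one hE h').neg).add h'
  convert key using 1
  · ext x y
    split_ifs <;> simp
  · ring

end HasGram

theorem EqProtocol.hasGram_eval {X Y : Type*} (P : EqProtocol X Y) :
    HasGram (fun x y => if P.eval x y = true then (1 : ℝ) else 0) (3 ^ P.cost) := by
  have step : ∀ (E : X → Y → Prop) [∀ x y, Decidable (E x y)] (P₀ P₁ : EqProtocol X Y),
      HasGram (fun x y => if E x y then (1 : ℝ) else 0) 1 →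
      HasGram (fun x y => if P₀.eval x y = true then (1 : ℝ) else 0) (3 ^ P₀.cost) →
      HasGram (fun x y => if P₁.eval x y = true then (1 : ℝ) else 0) (3 ^ P₁.cost) →
      HasGram (fun x y => if (if E x y then P₁.eval x y else P₀.eval x y) = true
        then (1 : ℝ) else 0) (3 ^ (max P₀.cost P₁.cost + 1)) := by
    intro E _ P₀ P₁ hE h₀ h₁
    have h := HasGram.ite (r := 3 ^ max P₀.cost P₁.cost) hE
      (h₁.mono (pow_le_pow_right₀ (by norm_num) (le_max_right _ _)))
      (h₀.mono (pow_le_pow_right₀ (by norm_num) (le_max_left _ _)))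
    rw [← pow_succ'] at h
    convert h using 3 with x y
    split_ifs <;> rfl
  induction P with
  | output b =>
    simp only [eval, cost, pow_zero]
    exact HasGram.const (c := if b = true then 1 else 0) (by split_ifs <;> norm_num)
  -- An announced bit is an Equality test against the constant `true`.
  | alice a P₀ P₁ h₀ h₁ => exact step (fun x _ => a x = true) P₀ P₁ (HasGram.ite_eq a fun _ => true) h₀ h₁
  | bob b P₀ P₁ h₀ h₁ =>
    refine step (fun _ y => b y = true) P₀ P₁ ?_ h₀ h₁
    simpa only [eq_comm] using HasGram.ite_eq (fun _ : X => true) b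
  | query k a b P₀ P₁ h₀ h₁ => exact step (fun x y => a x = b y) P₀ P₁ (HasGram.ite_eq a b) h₀ h₁

theorem two_pow_sub_two_le_three_pow_DEq {n : ℕ} (hn : 1 ≤ n) :
    (2 : ℝ) ^ n - 2 ≤ 4 * 3 ^ DEq (RankOne n) := by
  obtain ⟨P, hP, hc⟩ : DEq (RankOne n) ∈ {c : ℕ | ∃ P : EqProtocol _ _,
      (∀ x y, P.eval x y = RankOne n x y) ∧ P.cost = c} := by
    refine Nat.sInf_mem ?_
    obtain ⟨P, hP⟩ := EqProtocol.exists_computes (RankOne n)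
    exact ⟨_, P, hP, rfl⟩
  obtain ⟨κ, _, u, v, hM, hu, hv⟩ := P.hasGram_eval
  rw [hc] at hu hv
  -- `HasGram` bounds squared lengths, so both norms are at most this root and their product is at
  -- most `3 ^ DEq (RankOne n)`.
  have hsq : √((3 : ℝ) ^ DEq (RankOne n)) ^ 2 = 3 ^ DEq (RankOne n) := Real.sq_sqrt (by positivity)
  have key := two_pow_sub_two_le_of_factorization hn (U := Matrix.of u)
    (V := (Matrix.of v).transpose) ?_ (Real.sqrt_nonneg (3 ^ DEq (RankOne n)))
    (Real.sqrt_nonneg (3 ^ DEq (RankOne n))) ?_ ?_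
  · rwa [← sq, hsq] at key
  · ext A B
    simp [Matrix.mul_apply, ← hM, problemMatrix, hP]
  · intro A
    rw [hsq]
    exact hu A
  · intro B
    rw [hsq]
    exact hv B

/-! ### Asymptotic form of the bounds -/

/-- With `t = 2 ^ (n / 2)` this reads `4 t ≤ t ^ 2 - 2`, which holds once `t ≥ 8`. -/
theorem two_rpow_half_mul_le {n : ℕ} (hn : 8 ≤ n) :
    (2 : ℝ) ^ ((1 / 2 : ℝ) * n) ≤ ((2 : ℝ) ^ n - 2) / 4 := by
  set t : ℝ := (2 : ℝ) ^ ((1 / 2 : ℝ) * n)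
  have ht : t ^ 2 = 2 ^ n := by
    rw [← Real.rpow_natCast t, ← Real.rpow_mul (by norm_num), ← Real.rpow_natCast]
    congr 1
    push_cast
    ring
  have h8 : (8 : ℝ) ≤ t := by
    have h : (2 : ℝ) ^ (3 : ℝ) ≤ t := by
      refine Real.rpow_le_rpow_of_exponent_le (by norm_num) ?_
      have : (8 : ℝ) ≤ n := by exact_mod_cast hn
      linarith
    norm_num at h
    exact h
  rw [← ht]
  nlinarith

theorem theorem4 :
    (∃ c C : ℝ, 0 < c ∧ 0 < C ∧ ∀ᶠ n : ℕ in atTop,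
      (2 : ℝ) ^ (c * (n : ℝ)) ≤ gamma2 (problemMatrix (RankOne n)) ∧
      gamma2 (problemMatrix (RankOne n)) ≤ (2 : ℝ) ^ (C * (n : ℝ))) ∧
    (∃ c : ℝ, 0 < c ∧ ∀ᶠ n : ℕ in atTop, c * (n : ℝ) ≤ (DEq (RankOne n) : ℝ)) := by
  refine ⟨⟨1 / 2, 1, by norm_num, by norm_num, ?_⟩, 1 / 4, by norm_num, ?_⟩
  · filter_upwards [eventually_ge_atTop 8] with n hn
    refine ⟨(two_rpow_half_mul_le hn).trans (two_pow_sub_two_le_gamma2_rankOne (by omega)), ?_⟩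
    rw [one_mul, Real.rpow_natCast]
    exact gamma2_rankOne_le n
  · filter_upwards [eventually_ge_atTop 8] with n hn
    have h1 := two_rpow_half_mul_le hn
    have h2 := two_pow_sub_two_le_three_pow_DEq (n := n) (by omega)
    -- Rounding 3 up to `4 = 2 ^ 2` gives `n / 2 ≤ 2 * DEq (RankOne n)`, whence the constant `1 /
    -- 4`.
    have h3 : (3 : ℝ) ^ DEq (RankOne n) ≤ 4 ^ DEq (RankOne n) :=
      pow_le_pow_left₀ (by norm_num) (by norm_num) _
    have h4 : (4 : ℝ) ^ DEq (RankOne n) = 2 ^ (2 * (DEq (RankOne n) : ℝ)) := by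
      rw [Real.rpow_mul (by norm_num), Real.rpow_natCast]
      norm_num
    have h5 : (2 : ℝ) ^ ((1 / 2 : ℝ) * n) ≤ 2 ^ (2 * (DEq (RankOne n) : ℝ)) := by linarith
    have h6 := (Real.rpow_le_rpow_left_iff (by norm_num : (1 : ℝ) < 2)).1 h5
    linarith
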